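/- Let $B_n$ denote the open unit ball of $\mathbb{C}^n$ with the Euclidean norm. A map $\phi\colon B_2\to B_k$ is called *monomial of degree $d$* if each of its $k$ components is a monomial $C z_1^{a_1}z_2^{a_2}$ with $C\in\mathbb{C}$ (possibly $C=0$), and $d$ is the largest degree $a_1+a_2$ of a nonzero component (with $d=0$ if all components vanish). It is *proper* if the preimage of every compact subset of $B_k$ is a compact subset of $B_2$. For a polynomial $p$ let $\rho(p)$ be the number of distinct monomials that appear in $p$ with non-zero coefficient. 1. If $\phi\colon B_2\to B_k$ is a proper monomial map of degree $d$, then $d\le 2k-3$. 2. This is sharp: for every $k\ge 2$ there is a proper monomial map $B_2\to B_k$ of degree exactly $2k-3$. 3. (Homogeneous form.) Let $p\in\mathbb{R}[x_1,x_2,x_3]$ be homogeneous of degree $d$ with $p(0,0,x_3)=-(-x_3)^d$. Suppose that the polynomial $\tilde p$ defined by $p(x_1,x_2,-1)=\tilde p(x_1,x_2)-1$ has degree $d$ and only non-negative coefficients, and that $p=(x_1+x_2+x_3)\,q$ for some polynomial $q$. Then $\rho(p)\ge \frac{d+5}{2}$. 4. This is sharp: for every odd $d\geq 1$ there is a polynomial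 $p$ satisfying the hypotheses of part 3 with $\rho(p)=\frac{d+5}{2}$. -/

import Mathlib

/-- The open unit ball `B_n` of `ℂⁿ` (Euclidean norm), as a topological space. -/
abbrev UnitBall (n : ℕ) : Type :=
  Metric.ball (0 : EuclideanSpace ℂ (Fin n)) 1

/-- `φ : B_n → B_k` is a monomial mapping of degree `d`: its components are monomials
`C z^a` (with `C : ℂ`, possibly zero), and `d` is the largest degree of a component.
The polynomials `f i` are determined by `φ`. -/
def IsMonomialMapOfDegree {n k : ℕ} (φ : UnitBall n → UnitBall k) (d : ℕ) : Prop :=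
  ∃ f : Fin k → MvPolynomial (Fin n) ℂ,
    (∀ i, ∃ (a : Fin n →₀ ℕ) (C : ℂ), f i = MvPolynomial.monomial a C) ∧
    (∀ (z : UnitBall n) (i : Fin k),
      (φ z : EuclideanSpace ℂ (Fin k)) i =
        MvPolynomial.eval (fun j => (z : EuclideanSpace ℂ (Fin n)) j) (f i)) ∧
    Finset.univ.sup (fun i => (f i).totalDegree) = d

/-- The polynomial `p̃ ∈ ℝ[x₁, x₂]` defined by `p(x₁, x₂, -1) = p̃(x₁, x₂) - 1`. -/
noncomputable def tildePoly (p : MvPolynomial (Fin 3) ℝ) : MvPolynomial (Fin 2) ℝ :=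
  MvPolynomial.aeval ![MvPolynomial.X 0, MvPolynomial.X 1, -1] p + 1

/-- The hypotheses of the homogeneous form of the degree estimate, in three variables:
`p` is the homogenization, with `x₃` replaced by `-x₃`, of `p̃ - 1`, where `p̃` is a polynomial
of degree `d` with non-negative coefficients and no constant term, and `p` is a multiple of
`s = x₁ + x₂ + x₃`. -/
structure IsHomogForm (d : ℕ) (p : MvPolynomial (Fin 3) ℝ) : Prop where
  homogeneous : p.IsHomogeneous d
  eval_last : ∀ t : ℝ, MvPolynomial.eval ![0, 0, t] p = -(-t) ^ d
  coeff_nonneg : ∀ a, 0 ≤ (tildePoly p).coeff a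
  totalDegree_tilde : (tildePoly p).totalDegree = d
  dvd : ∃ q : MvPolynomial (Fin 3) ℝ,
    p = (MvPolynomial.X 0 + MvPolynomial.X 1 + MvPolynomial.X 2) * q

/-- `ρ(p)`: the number of distinct monomials appearing in `p` with non-zero coefficient. -/
def monomialRank {σ : Type*} (p : MvPolynomial σ ℝ) : ℕ := p.support.card

/-!
A monomial map `φ` of balls is proper iff it maps the unit sphere into the unit sphere. As `‖φ z‖²`
is a polynomial `f` with non-negative coefficients in `x = |z₁|²` and `y = |z₂|²`, this says that
`f - 1 = (x + y - 1) q` for some `q`. The homogeneous form leads to the same divisibility, with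
`f = p̃`, so both estimates are `deg f + 3 ≤ 2 ρ(f)`.

Arrange the coefficients of `q` in the triangle `i + j ≤ deg q`. The coefficient of `f - 1` at
`(i, j)` is `Q (i - 1, j) + Q (i, j - 1) - Q (i, j)`, so it cannot vanish if the first two entries
have one sign and the third one the opposite sign. Non-negativity of `f` provides a positive entry
in every row `i + j = m`, and therefore the zero entries can be given signs as well, in such a way
that this remains true. After multiplying the sign at `(i, j)` by `(-1) ^ (i + j)`, the nonzero
coefficients are found at the triangles with three equal signs and at the boundary edges with two
equal signs. As every triangle with vertices `±1` has edge product sum at least `-1`, there are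
many of them. Moreover, the sums of the array of `f - 1` along its three sides vanish (on the side
`i + j = deg f`, the alternating sum), so each side has two nonzero entries, as neither the
corner `(0, 0)` nor the whole row `deg f` is zero.

For sharpness, write `α ^ d + β ^ d` as a polynomial in `α + β` and `α β`. At `α = -x₂`, `β = -x₃`
with `d` odd it agrees with `-(x₂ ^ d + x₃ ^ d)`, so replacing `α + β` by `x₁` and `α β` by `x₂ x₃`
gives an `L` with `x₁ + x₂ + x₃ ∣ L + x₂ ^ d + x₃ ^ d`.
-/

section Triangle

open Finset

/-- The lattice points `(i, j)` with `i + j < n`: the exponents of the monomials of degree less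
than `n` in two variables. -/
def triangle (n : ℕ) : Finset (ℕ × ℕ) := {p ∈ range n ×ˢ range n | p.1 + p.2 < n}

lemma mem_triangle {n : ℕ} {p : ℕ × ℕ} : p ∈ triangle n ↔ p.1 + p.2 < n := by
  simp only [triangle, mem_filter, mem_product, mem_range]
  omega

variable {M : Type*} [AddCommMonoid M]

lemma sum_triangle (n : ℕ) (g : ℕ × ℕ → M) :
    ∑ p ∈ triangle n, g p = ∑ m ∈ range n, ∑ p ∈ antidiagonal m, g p := by
  rw [← sum_fiberwise_of_maps_to (g := fun p => p.1 + p.2)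
    fun p hp => mem_range.2 (mem_triangle.1 hp)]
  refine sum_congr rfl fun m hm => sum_congr (ext fun p => ?_) fun _ _ => rfl
  rw [mem_filter, mem_triangle, HasAntidiagonal.mem_antidiagonal]
  have := mem_range.1 hm
  omega

lemma sum_triangle_succ (n : ℕ) (g : ℕ × ℕ → M) :
    ∑ p ∈ triangle (n + 1), g p = ∑ p ∈ triangle n, g p + ∑ p ∈ antidiagonal n, g p := by
  simp only [sum_triangle, sum_range_succ]

lemma sum_triangle_succ_left (n : ℕ) (g : ℕ × ℕ → M) :
    ∑ p ∈ triangle (n + 1), g p =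
      ∑ p ∈ triangle n, g (p.1 + 1, p.2) + ∑ j ∈ range (n + 1), g (0, j) := by
  simp only [sum_triangle, sum_range_succ', Nat.sum_antidiagonal_succ,
    sum_add_distrib, Nat.antidiagonal_zero, sum_singleton]
  abel

lemma sum_triangle_succ_right (n : ℕ) (g : ℕ × ℕ → M) :
    ∑ p ∈ triangle (n + 1), g p =
      ∑ p ∈ triangle n, g (p.1, p.2 + 1) + ∑ i ∈ range (n + 1), g (i, 0) := by
  simp only [sum_triangle, sum_range_succ', Nat.sum_antidiagonal_succ',
    sum_add_distrib, Nat.antidiagonal_zero, sum_singleton]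
  abel

lemma card_triangle_succ (n : ℕ) : (triangle (n + 1)).card = (triangle n).card + (n + 1) := by
  simpa only [sum_const, smul_eq_mul, mul_one, Nat.card_antidiagonal] using
    sum_triangle_succ n fun _ => (1 : ℕ)

/-- Interior points count twice; edge points once among the edges and once in the sums over full
sides; corner points lie on two sides. -/
lemma two_nsmul_sum_triangle (n : ℕ) (g : ℕ × ℕ → M) :
    2 • ∑ p ∈ triangle (n + 3), g p =
      2 • ∑ p ∈ triangle n, g (p.1 + 1, p.2 + 1) + ∑ i ∈ range (n + 1), g (i + 1, 0) +
        ∑ j ∈ range (n + 1), g (0, j + 1) +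
        ∑ p ∈ antidiagonal n, g (p.1 + 1, p.2 + 1) +
      (∑ i ∈ range (n + 3), g (i, 0) + ∑ j ∈ range (n + 3), g (0, j) +
        ∑ p ∈ antidiagonal (n + 2), g p) := by
  have hthrough_top : ∑ p ∈ triangle (n + 3), g p =
      ∑ p ∈ triangle n, g (p.1 + 1, p.2 + 1) + ∑ i ∈ range (n + 1), g (i + 1, 0) +
        (∑ j ∈ range (n + 1), g (0, j + 1) + g (0, 0)) + ∑ p ∈ antidiagonal (n + 2), g p := by
    rw [sum_triangle_succ, sum_triangle_succ_left, sum_triangle_succ_right,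
      sum_range_succ' fun j => g (0, j)]
  have hthrough_sides : ∑ p ∈ triangle (n + 3), g p =
      ∑ p ∈ triangle n, g (p.1 + 1, p.2 + 1) + ∑ p ∈ antidiagonal n, g (p.1 + 1, p.2 + 1) +
        ∑ i ∈ range (n + 2), g (i + 1, 0) + ∑ j ∈ range (n + 3), g (0, j) := by
    rw [sum_triangle_succ_left, sum_triangle_succ_right, sum_triangle_succ]
  rw [two_nsmul, sum_range_succ' fun i => g (i, 0)]
  nth_rw 1 [hthrough_top]
  rw [hthrough_sides]
  abel

end Triangle

section Labelling

open Finset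

lemma units_mul_eq (u v : ℤˣ) : (u * v : ℤ) = 2 * (if u = v then 1 else 0) - 1 := by
  revert u v; decide

lemma units_mul_add_mul_add_mul (u v w : ℤˣ) :
    (u * v + u * w + v * w : ℤ) = 4 * (if u = v ∧ v = w then 1 else 0) - 1 := by
  revert u v w; decide

lemma neg_one_le_units_mul_add_mul_add_mul (u v w : ℤˣ) :
    (-1 : ℤ) ≤ u * v + u * w + v * w := by
  revert u v w; decide

/-- Every edge of the triangular grid lies in one triangle `(i, j), (i + 1, j), (i, j + 1)` and,
unless it is on the boundary, in one triangle `(i + 1, j), (i, j + 1), (i + 1, j + 1)`. So the sums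
of `t u * t v` over the edges of all triangles of either kind differ by the sum over the
boundary. -/
lemma succ_le_two_mul_monochromatic_add_boundary (t : ℕ × ℕ → ℤˣ) (n : ℕ) :
    (n + 1 : ℤ) ≤
      2 * ∑ p ∈ triangle n, (if t (p.1 + 1, p.2) = t (p.1, p.2 + 1) ∧
        t (p.1, p.2 + 1) = t (p.1 + 1, p.2 + 1) then 1 else 0) +
      ∑ i ∈ range (n + 1), (if t (i, 0) = t (i + 1, 0) then 1 else 0) +
      ∑ j ∈ range (n + 1), (if t (0, j) = t (0, j + 1) then 1 else 0) +
      ∑ p ∈ antidiagonal n, (if t (p.1 + 1, p.2) = t (p.1, p.2 + 1) then 1 else 0) := by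
  have hdown : ∑ _p ∈ triangle (n + 1), (-1 : ℤ) ≤ ∑ p ∈ triangle (n + 1),
      (t p * t (p.1 + 1, p.2) + t p * t (p.1, p.2 + 1) + t (p.1 + 1, p.2) * t (p.1, p.2 + 1) : ℤ) :=
    sum_le_sum fun _ _ => neg_one_le_units_mul_add_mul_add_mul _ _ _
  have hup : ∑ p ∈ triangle n, (t (p.1 + 1, p.2) * t (p.1, p.2 + 1) +
        t (p.1 + 1, p.2) * t (p.1 + 1, p.2 + 1) + t (p.1, p.2 + 1) * t (p.1 + 1, p.2 + 1) : ℤ) =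
      ∑ p ∈ triangle n, (4 * (if t (p.1 + 1, p.2) = t (p.1, p.2 + 1) ∧
        t (p.1, p.2 + 1) = t (p.1 + 1, p.2 + 1) then 1 else 0) - 1) :=
    sum_congr rfl fun _ _ => units_mul_add_mul_add_mul _ _ _
  rw [sum_add_distrib, sum_add_distrib,
    sum_triangle_succ_right _ fun p => (t p * t (p.1 + 1, p.2) : ℤ),
    sum_triangle_succ_left _ fun p => (t p * t (p.1, p.2 + 1) : ℤ),
    sum_triangle_succ _ fun p => (t (p.1 + 1, p.2) * t (p.1, p.2 + 1) : ℤ)] at hdown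
  simp only [units_mul_eq, sum_sub_distrib, sum_add_distrib, ← mul_sum, sum_const,
    nsmul_eq_mul, card_triangle_succ, card_range, Nat.card_antidiagonal] at hdown hup ⊢
  push_cast at hdown hup ⊢
  linarith

end Labelling

section Counting

open Finset

variable {M : Type*}

open Classical in
/-- The indicator of a nonzero element, for counting the nonzero entries of an array. -/
noncomputable def nonzeroInd [Zero M] (r : M) : ℤ := if r = 0 then 0 else 1

lemma nonzeroInd_nonneg [Zero M] (r : M) : 0 ≤ nonzeroInd r := by
  unfold nonzeroInd
  split_ifs <;> norm_num

lemma nonzeroInd_of_ne [Zero M] {r : M} (h : r ≠ 0) : nonzeroInd r = 1 := if_neg h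

lemma ite_le_nonzeroInd [Zero M] {r : M} {P : Prop} [Decidable P] (h : P → r ≠ 0) :
    (if P then 1 else 0) ≤ nonzeroInd r := by
  split_ifs with hP
  · exact (nonzeroInd_of_ne (h hP)).ge
  · exact nonzeroInd_nonneg r

lemma nonzeroInd_neg_one_pow_smul [AddGroup M] (k : ℕ) (r : M) :
    nonzeroInd ((-1 : ℤ) ^ k • r) = nonzeroInd r := by
  have hiff : (-1 : ℤ) ^ k • r = 0 ↔ r = 0 := by
    obtain h | h := neg_one_pow_eq_or ℤ k <;> simp only [h, one_zsmul, neg_zsmul, neg_eq_zero]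
  unfold nonzeroInd
  congr 1
  exact propext hiff

lemma sum_nonzeroInd [Zero M] {ι : Type*} (s : Finset ι) (g : ι → M) [DecidablePred (g · ≠ 0)] :
    ∑ i ∈ s, nonzeroInd (g i) = #{i ∈ s | g i ≠ 0} := by
  rw [card_filter, Nat.cast_sum]
  refine sum_congr rfl fun i _ => ?_
  by_cases h : g i = 0 <;> simp [nonzeroInd, h]

lemma two_le_sum_nonzeroInd [AddCommMonoid M] {ι : Type*} {s : Finset ι} {g : ι → M}
    (hsum : ∑ i ∈ s, g i = 0) {i : ι} (hi : i ∈ s) (hgi : g i ≠ 0) :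
    2 ≤ ∑ j ∈ s, nonzeroInd (g j) := by
  classical
  obtain ⟨j, hj, hgj⟩ : ∃ j ∈ s.erase i, g j ≠ 0 := by
    refine exists_ne_zero_of_sum_ne_zero fun h => hgi ?_
    rwa [← add_sum_erase s g hi, h, add_zero] at hsum
  have htwo : 1 < #{j ∈ s | g j ≠ 0} :=
    one_lt_card.2 ⟨i, mem_filter.2 ⟨hi, hgi⟩, j, mem_filter.2 ⟨mem_of_mem_erase hj, hgj⟩,
      (ne_of_mem_erase hj).symm⟩
  rw [sum_nonzeroInd]
  exact_mod_cast htwo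

end Counting

section LineMul

open Finset

variable {R : Type*}

/-- The coefficient array of `x * q`, for the polynomial `q = ∑ Q (i, j) x ^ i y ^ j`. -/
def xShift [Zero R] (Q : ℕ × ℕ → R) : ℕ × ℕ → R
  | (0, _) => 0
  | (i + 1, j) => Q (i, j)

/-- The coefficient array of `y * q`, for the polynomial `q = ∑ Q (i, j) x ^ i y ^ j`. -/
def yShift [Zero R] (Q : ℕ × ℕ → R) : ℕ × ℕ → R
  | (_, 0) => 0
  | (i, j + 1) => Q (i, j)

/-- The coefficient array of `(x + y - 1) * q`, for the polynomial `q = ∑ Q (i, j) x ^ i y ^ j`. -/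
def lineMul [AddGroup R] (Q : ℕ × ℕ → R) (p : ℕ × ℕ) : R := xShift Q p + yShift Q p - Q p

section AddCommGroup

variable [AddCommGroup R] (Q : ℕ × ℕ → R)

lemma lineMul_zero_zero : lineMul Q (0, 0) = -Q (0, 0) := by
  simp only [lineMul, xShift, yShift, zero_add, zero_sub]

lemma lineMul_succ_zero (i : ℕ) : lineMul Q (i + 1, 0) = Q (i, 0) - Q (i + 1, 0) := by
  simp only [lineMul, xShift, yShift, add_zero]

lemma lineMul_zero_succ (j : ℕ) : lineMul Q (0, j + 1) = Q (0, j) - Q (0, j + 1) := by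
  simp only [lineMul, xShift, yShift, zero_add]

lemma lineMul_succ_succ (i j : ℕ) :
    lineMul Q (i + 1, j + 1) = Q (i, j + 1) + Q (i + 1, j) - Q (i + 1, j + 1) := by
  simp only [lineMul, xShift, yShift]

lemma sum_lineMul_left (n : ℕ) : ∑ j ∈ range (n + 1), lineMul Q (0, j) = -Q (0, n) := by
  simp only [sum_range_succ', lineMul_zero_succ, lineMul_zero_zero, sum_range_sub']
  abel

lemma sum_lineMul_right (n : ℕ) : ∑ i ∈ range (n + 1), lineMul Q (i, 0) = -Q (n, 0) := by
  simp only [sum_range_succ', lineMul_succ_zero, lineMul_zero_zero, sum_range_sub']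
  abel

lemma sum_antidiagonal_neg_one_pow_smul_shifts (n : ℕ) :
    ∑ p ∈ antidiagonal (n + 1), (-1 : ℤ) ^ p.1 • (xShift Q p + yShift Q p) = 0 := by
  simp only [smul_add, sum_add_distrib]
  rw [Nat.sum_antidiagonal_succ, Nat.sum_antidiagonal_succ']
  simp only [xShift, yShift, smul_zero, zero_add, pow_succ, mul_neg, mul_one, neg_smul,
    sum_neg_distrib, neg_add_cancel]

lemma two_le_sum_nonzeroInd_lineMul_antidiagonal {Q : ℕ × ℕ → R} {n : ℕ}
    (hQ : ∀ p ∈ antidiagonal (n + 1), Q p = 0) {p : ℕ × ℕ} (hp : p ∈ antidiagonal (n + 1))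
    (hpQ : lineMul Q p ≠ 0) : 2 ≤ ∑ p ∈ antidiagonal (n + 1), nonzeroInd (lineMul Q p) := by
  have hsum : ∑ p ∈ antidiagonal (n + 1), (-1 : ℤ) ^ p.1 • lineMul Q p = 0 := by
    rw [← sum_antidiagonal_neg_one_pow_smul_shifts Q n]
    exact sum_congr rfl fun p hp => by rw [lineMul, hQ p hp, sub_zero]
  rw [← sum_congr rfl fun p _ => nonzeroInd_neg_one_pow_smul p.1 (lineMul Q p)]
  exact two_le_sum_nonzeroInd hsum hp ((isUnit_one.neg.pow p.1).smul_eq_zero.not.2 hpQ)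

end AddCommGroup

end LineMul

section SignFilling

open Finset

variable {R : Type*} {Q : ℕ × ℕ → R} {n : ℕ} {s : ℕ × ℕ → ℤˣ}

/-- A choice of signs for the entries of `Q`, including the zero ones, on the triangle `i + j ≤ n`:
neighbouring zeros of a row get different signs and the zeros on the two axes count as positive. -/
structure IsSignFilling [Zero R] [LE R] (n : ℕ) (Q : ℕ × ℕ → R) (s : ℕ × ℕ → ℤˣ) : Prop where
  nonneg : ∀ {p}, s p = 1 → 0 ≤ Q p
  nonpos : ∀ {p}, s p = -1 → Q p ≤ 0
  ne_of_eq_zero : ∀ {i j}, i + j + 1 ≤ n → Q (i + 1, j) = 0 → Q (i, j + 1) = 0 →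
    s (i + 1, j) ≠ s (i, j + 1)
  left : ∀ {j}, j ≤ n → Q (0, j) = 0 → s (0, j) = 1
  right : ∀ {i}, i ≤ n → Q (i, 0) = 0 → s (i, 0) = 1

/-- The zeros of a row are signed alternatingly from each end of the row inwards; the two patterns
need not match where they meet, so they are made to meet at a positive entry. -/
lemma exists_isSignFilling [Zero R] [LinearOrder R]
    (hpos : ∀ m ≤ n, ∃ p ∈ antidiagonal m, 0 < Q p) :
    ∃ s, IsSignFilling n Q s := by
  choose! x hx hxpos using hpos
  simp only [HasAntidiagonal.mem_antidiagonal] at hx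
  have hx_ne {p : ℕ × ℕ} (hp : p.1 + p.2 ≤ n) (hQ : Q p = 0) : p.1 ≠ (x (p.1 + p.2)).1 := by
    intro h
    have hsum := hx _ hp
    exact (hxpos _ hp).ne' ((Prod.ext h (by lia) : p = x (p.1 + p.2)) ▸ hQ)
  let z (p : ℕ × ℕ) : ℤˣ := if p.1 < (x (p.1 + p.2)).1 then (-1) ^ p.1 else (-1) ^ p.2
  let s (p : ℕ × ℕ) : ℤˣ := if 0 < Q p then 1 else if Q p < 0 then -1 else z p
  have hs {p : ℕ × ℕ} (hp : Q p = 0) : s p = z p := by simp [s, hp]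
  refine ⟨s, ⟨fun {p} h => ?_, fun {p} h => ?_, fun {i j} hn h₁ h₂ => ?_, fun {j} hn h => ?_,
    fun {i} hn h => ?_⟩⟩
  · by_contra! hlt
    simp [s, hlt, hlt.not_gt] at h
  · by_contra! hlt
    simp [s, hlt] at h
  · have hx₁ := hx_ne (by lia) h₁
    have hx₂ := hx_ne (by lia) h₂
    rw [hs h₁, hs h₂]
    simp only [z, add_right_comm i 1 j, ← add_assoc] at hx₁ hx₂ ⊢
    rcases lt_or_gt_of_ne hx₁ with hlt | hlt
    · rw [if_pos hlt, if_pos (by lia), pow_succ, mul_neg_one]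
      exact neg_units_ne_self _
    · rw [if_neg (by lia), if_neg (by lia), pow_succ, mul_neg_one]
      exact units_ne_neg_self _
  · have hx₀ := hx_ne (p := (0, j)) (by lia) h
    rw [hs h]
    exact if_pos (by lia)
  · have hx₀ := hx_ne (p := (i, 0)) hn h
    have hsum := hx i hn
    rw [hs h]
    exact if_neg (by simp only [add_zero]; lia)

lemma IsSignFilling.eq_zero_of_eq_neg [Zero R] [PartialOrder R]
    (h : IsSignFilling n Q s) {p q : ℕ × ℕ} (hs : s p = -s q) (hQ : Q p = Q q) :
    Q p = 0 := by
  obtain hq | hq := Int.units_eq_one_or (s q)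
  · exact (h.nonpos (by rw [hs, hq])).antisymm (hQ ▸ h.nonneg hq)
  · exact (hQ ▸ h.nonpos hq).antisymm (h.nonneg (by rw [hs, hq, neg_neg]))

lemma IsSignFilling.lineMul_zero_succ_ne_zero [AddCommGroup R] [PartialOrder R]
    (h : IsSignFilling n Q s) {j : ℕ} (hj : j + 1 ≤ n)
    (hs : s (0, j) = -s (0, j + 1)) : lineMul Q (0, j + 1) ≠ 0 := by
  intro h₀
  rw [lineMul_zero_succ, sub_eq_zero] at h₀
  have hzero := h.eq_zero_of_eq_neg hs h₀
  rw [h.left (by lia) hzero, h.left hj (h₀ ▸ hzero)] at hs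
  exact absurd hs (by decide)

lemma IsSignFilling.lineMul_succ_zero_ne_zero [AddCommGroup R] [PartialOrder R]
    (h : IsSignFilling n Q s) {i : ℕ} (hi : i + 1 ≤ n)
    (hs : s (i, 0) = -s (i + 1, 0)) : lineMul Q (i + 1, 0) ≠ 0 := by
  intro h₀
  rw [lineMul_succ_zero, sub_eq_zero] at h₀
  have hzero := h.eq_zero_of_eq_neg hs h₀
  rw [h.right (by lia) hzero, h.right hi (h₀ ▸ hzero)] at hs
  exact absurd hs (by decide)

end SignFilling

section OrderedGroup

open Finset

variable {R : Type*} [AddCommGroup R] [LinearOrder R] [IsOrderedAddMonoid R] {Q : ℕ × ℕ → R} {n : ℕ}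

lemma exists_pos_of_pos_shifts {m : ℕ} {p : ℕ × ℕ} (hp : p ∈ antidiagonal (m + 1))
    (hpos : 0 < xShift Q p + yShift Q p) : ∃ q ∈ antidiagonal m, 0 < Q q := by
  rw [HasAntidiagonal.mem_antidiagonal] at hp
  match p, hp, hpos with
  | (0, j + 1), hp, hpos =>
    exact ⟨(0, j), HasAntidiagonal.mem_antidiagonal.2 (by lia),
      by simpa [xShift, yShift] using hpos⟩
  | (i + 1, 0), hp, hpos =>
    exact ⟨(i, 0), HasAntidiagonal.mem_antidiagonal.2 (by lia),
      by simpa [xShift, yShift] using hpos⟩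
  | (i + 1, j + 1), hp, hpos =>
    obtain h | h : 0 < Q (i, j + 1) ∨ 0 < Q (i + 1, j) := by
      by_contra! h
      exact hpos.not_ge (add_nonpos h.1 h.2)
    · exact ⟨_, HasAntidiagonal.mem_antidiagonal.2 (by lia), h⟩
    · exact ⟨_, HasAntidiagonal.mem_antidiagonal.2 (by lia), h⟩

lemma exists_pos_antidiagonal (hdeg : ∀ p : ℕ × ℕ, n < p.1 + p.2 → Q p = 0)
    (hnonneg : ∀ p ≠ 0, 0 ≤ lineMul Q p) (htop : ∃ p ∈ antidiagonal (n + 1), lineMul Q p ≠ 0)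
    {m : ℕ} (hm : m ≤ n) : ∃ p ∈ antidiagonal m, 0 < Q p := by
  have hne {k : ℕ} {p : ℕ × ℕ} (hp : p ∈ antidiagonal (k + 1)) : p ≠ 0 := by
    rintro rfl
    simp at hp
  induction hm using Nat.decreasingInduction with
  | self =>
    obtain ⟨p, hp, hpQ⟩ := htop
    have hQ : Q p = 0 := hdeg p (by rw [HasAntidiagonal.mem_antidiagonal.1 hp]; lia)
    have hpos : 0 < lineMul Q p := (hnonneg p (hne hp)).lt_of_ne' hpQ
    exact exists_pos_of_pos_shifts hp (by rwa [lineMul, hQ, sub_zero] at hpos)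
  | of_succ m _ ih =>
    obtain ⟨p, hp, hpQ⟩ := ih
    exact exists_pos_of_pos_shifts hp (hpQ.trans_le (sub_nonneg.1 (hnonneg p (hne hp))))

namespace IsSignFilling

variable {s : ℕ × ℕ → ℤˣ}

lemma add_ne_zero (h : IsSignFilling n Q s) {i j : ℕ} (hij : i + j + 1 ≤ n)
    (hs : s (i + 1, j) = s (i, j + 1)) : Q (i, j + 1) + Q (i + 1, j) ≠ 0 := by
  intro h₀
  obtain ⟨hj, hi⟩ : Q (i, j + 1) = 0 ∧ Q (i + 1, j) = 0 := by
    obtain hsj | hsj := Int.units_eq_one_or (s (i, j + 1))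
    · exact (add_eq_zero_iff_of_nonneg (h.nonneg hsj) (h.nonneg (hs.trans hsj))).1 h₀
    · have hj := h.nonpos hsj
      have hi := h.nonpos (hs.trans hsj)
      exact ⟨eq_zero_of_add_nonneg_left hj hi h₀.ge, eq_zero_of_add_nonneg_right hj hi h₀.ge⟩
  exact h.ne_of_eq_zero hij hi hj hs

lemma lineMul_succ_succ_ne_zero (h : IsSignFilling n Q s) {i j : ℕ} (hij : i + j + 1 ≤ n)
    (hs : s (i + 1, j) = s (i, j + 1)) (hs' : s (i, j + 1) = -s (i + 1, j + 1)) :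
    lineMul Q (i + 1, j + 1) ≠ 0 := by
  intro h₀
  have hadd := h.add_ne_zero hij hs
  rw [lineMul_succ_succ, sub_eq_zero] at h₀
  obtain hsj | hsj := Int.units_eq_one_or (s (i, j + 1))
  · have hnonpos := h.nonpos (p := (i + 1, j + 1)) (by rw [← neg_neg (s _), ← hs', hsj])
    exact hadd ((h₀ ▸ hnonpos).antisymm (add_nonneg (h.nonneg hsj) (h.nonneg (hs.trans hsj))))
  · have hnonneg := h.nonneg (p := (i + 1, j + 1)) (by rw [← neg_neg (s _), ← hs', hsj, neg_neg])
    exact hadd ((add_nonpos (h.nonpos hsj) (h.nonpos (hs.trans hsj))).antisymm (h₀ ▸ hnonneg))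

lemma succ_le_sum_nonzeroInd_lineMul (h : IsSignFilling (n + 1) Q s)
    (hdeg : ∀ p : ℕ × ℕ, n + 1 < p.1 + p.2 → Q p = 0) :
    (n + 1 : ℤ) ≤
      2 * ∑ p ∈ triangle n, nonzeroInd (lineMul Q (p.1 + 1, p.2 + 1)) +
      ∑ i ∈ range (n + 1), nonzeroInd (lineMul Q (i + 1, 0)) +
      ∑ j ∈ range (n + 1), nonzeroInd (lineMul Q (0, j + 1)) +
      ∑ p ∈ antidiagonal n, nonzeroInd (lineMul Q (p.1 + 1, p.2 + 1)) := by
  refine (succ_le_two_mul_monochromatic_add_boundary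
    (fun p => (-1) ^ (p.1 + p.2) * s p) n).trans ?_
  simp only [pow_add, pow_succ, mul_neg, mul_one, neg_mul, neg_neg, neg_inj, mul_right_inj,
    add_zero, zero_add]
  simp only [neg_eq_iff_eq_neg, ← mul_neg, mul_right_inj]
  gcongr with p hp i hi j hj p hp <;> refine ite_le_nonzeroInd fun ht => ?_
  · have := mem_triangle.1 hp
    exact h.lineMul_succ_succ_ne_zero (by lia) ht.1 ht.2
  · exact h.lineMul_succ_zero_ne_zero (mem_range.1 hi) ht
  · exact h.lineMul_zero_succ_ne_zero (mem_range.1 hj) ht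
  · have hsum := HasAntidiagonal.mem_antidiagonal.1 hp
    rw [lineMul_succ_succ, hdeg (p.1 + 1, p.2 + 1) (by lia), sub_zero]
    exact h.add_ne_zero (by lia) ht

end IsSignFilling

theorem add_six_le_two_mul_sum_nonzeroInd_lineMul (hdeg : ∀ p : ℕ × ℕ, n < p.1 + p.2 → Q p = 0)
    (hnonneg : ∀ p ≠ 0, 0 ≤ lineMul Q p) (htop : ∃ p ∈ antidiagonal (n + 1), lineMul Q p ≠ 0) :
    (n + 6 : ℤ) ≤ 2 * ∑ p ∈ triangle (n + 2), nonzeroInd (lineMul Q p) := by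
  have hpos : ∀ m ≤ n, ∃ p ∈ antidiagonal m, 0 < Q p :=
    fun m hm => exists_pos_antidiagonal hdeg hnonneg htop hm
  have hapex : lineMul Q (0, 0) ≠ 0 := by
    obtain ⟨p, hp, hpQ⟩ := hpos 0 n.zero_le
    rw [Nat.antidiagonal_zero, mem_singleton] at hp
    rw [lineMul_zero_zero, neg_ne_zero]
    exact hp ▸ hpQ.ne'
  have hleft : 2 ≤ ∑ j ∈ range (n + 2), nonzeroInd (lineMul Q (0, j)) :=
    two_le_sum_nonzeroInd (by rw [sum_lineMul_left, hdeg (0, n + 1) (by lia), neg_zero])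
      (mem_range.2 (by lia)) hapex
  have hright : 2 ≤ ∑ i ∈ range (n + 2), nonzeroInd (lineMul Q (i, 0)) :=
    two_le_sum_nonzeroInd (by rw [sum_lineMul_right, hdeg (n + 1, 0) (by lia), neg_zero])
      (mem_range.2 (by lia)) hapex
  have hlast : 2 ≤ ∑ p ∈ antidiagonal (n + 1), nonzeroInd (lineMul Q p) := by
    obtain ⟨p, hp, hpQ⟩ := htop
    refine two_le_sum_nonzeroInd_lineMul_antidiagonal (fun q hq => hdeg q ?_) hp hpQ
    rw [HasAntidiagonal.mem_antidiagonal.1 hq]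
    exact n.lt_succ_self
  cases n with
  | zero =>
    simp only [sum_triangle, sum_range_succ, sum_range_zero, Nat.sum_antidiagonal_succ,
      Nat.antidiagonal_zero, sum_singleton, zero_add, Nat.cast_zero] at hleft hright hlast ⊢
    linarith
  | succ n =>
    obtain ⟨s, hs⟩ := exists_isSignFilling hpos
    have hcount := hs.succ_le_sum_nonzeroInd_lineMul hdeg
    have htriangle := two_nsmul_sum_triangle n fun p => nonzeroInd (lineMul Q p)
    rw [two_nsmul, two_nsmul] at htriangle
    push_cast
    linarith

end OrderedGroup

section LineMultiples

open Finset MvPolynomial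

/-- The exponent of the monomial `x ^ i * y ^ j`, for `p = (i, j)`. -/
noncomputable def expPair (p : ℕ × ℕ) : Fin 2 →₀ ℕ := Finsupp.single 0 p.1 + Finsupp.single 1 p.2

lemma expPair_apply_zero (p : ℕ × ℕ) : expPair p 0 = p.1 := by simp [expPair]

lemma expPair_apply_one (p : ℕ × ℕ) : expPair p 1 = p.2 := by simp [expPair]

lemma expPair_injective : Function.Injective expPair := fun p q h =>
  Prod.ext (by rw [← expPair_apply_zero, h, expPair_apply_zero])
    (by rw [← expPair_apply_one, h, expPair_apply_one])

lemma expPair_surjective : Function.Surjective expPair := fun e =>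
  ⟨(e 0, e 1), by ext i; fin_cases i <;> simp [expPair]⟩

lemma degree_expPair (p : ℕ × ℕ) : (expPair p).degree = p.1 + p.2 := by simp [expPair]

lemma expPair_eq_zero {p : ℕ × ℕ} : expPair p = 0 ↔ p = 0 :=
  expPair_injective.eq_iff' (by simp [expPair])

section CommRing

variable {R : Type*} [CommRing R]

/-- The coefficients of a polynomial in two variables, as an array. -/
noncomputable def coeffArray (f : MvPolynomial (Fin 2) R) (p : ℕ × ℕ) : R := coeff (expPair p) f

lemma coeffArray_X_zero_mul (f : MvPolynomial (Fin 2) R) :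
    coeffArray (X 0 * f) = xShift (coeffArray f) := by
  ext ⟨i, j⟩
  cases i with
  | zero => simp [coeffArray, xShift, coeff_X_mul', expPair]
  | succ i =>
    have hexp : expPair (i + 1, j) = Finsupp.single 0 1 + expPair (i, j) := by
      simp only [expPair, Finsupp.single_add]
      abel
    rw [coeffArray, hexp, coeff_X_mul]
    rfl

lemma coeffArray_X_one_mul (f : MvPolynomial (Fin 2) R) :
    coeffArray (X 1 * f) = yShift (coeffArray f) := by
  ext ⟨i, j⟩
  cases j with
  | zero => simp [coeffArray, yShift, coeff_X_mul', expPair]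
  | succ j =>
    have hexp : expPair (i, j + 1) = Finsupp.single 1 1 + expPair (i, j) := by
      simp only [expPair, Finsupp.single_add]
      abel
    rw [coeffArray, hexp, coeff_X_mul]
    rfl

lemma coeffArray_line_mul (f : MvPolynomial (Fin 2) R) :
    coeffArray ((X 0 + X 1 - 1) * f) = lineMul (coeffArray f) := by
  ext p
  rw [lineMul, ← coeffArray_X_zero_mul, ← coeffArray_X_one_mul, sub_mul, add_mul, one_mul]
  simp only [coeffArray, coeff_sub, coeff_add]

lemma coeffArray_eq_zero {f : MvPolynomial (Fin 2) R} {p : ℕ × ℕ} (h : f.totalDegree < p.1 + p.2) :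
    coeffArray f p = 0 :=
  coeff_eq_zero_of_totalDegree_lt (by rwa [← Finsupp.degree_apply, degree_expPair])

lemma exists_coeffArray_ne_zero {f : MvPolynomial (Fin 2) R} (hf : f ≠ 0) :
    ∃ p ∈ antidiagonal f.totalDegree, coeffArray f p ≠ 0 := by
  obtain ⟨e, he, hdeg⟩ := exists_mem_eq_sup f.support (support_nonempty.2 hf)
    fun s => s.sum fun _ k => k
  obtain ⟨p, rfl⟩ := expPair_surjective e
  refine ⟨p, HasAntidiagonal.mem_antidiagonal.2 ?_, mem_support_iff.1 he⟩
  rw [← degree_expPair]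
  exact hdeg.symm

lemma sum_nonzeroInd_coeffArray_le (f : MvPolynomial (Fin 2) R) (s : Finset (ℕ × ℕ)) :
    ∑ p ∈ s, nonzeroInd (coeffArray f p) ≤ #f.support := by
  classical
  rw [sum_nonzeroInd, Nat.cast_le]
  exact card_le_card_of_injOn expPair (fun p hp => mem_support_iff.2 (mem_filter.1 hp).2)
    expPair_injective.injOn

lemma one_le_totalDegree_line [Nontrivial R] :
    1 ≤ (X 0 + X 1 - 1 : MvPolynomial (Fin 2) R).totalDegree := by
  have hcoeff : coeffArray (X 0 + X 1 - 1 : MvPolynomial (Fin 2) R) (1, 0) ≠ 0 := by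
    rw [← mul_one (X 0 + X 1 - 1), coeffArray_line_mul, lineMul_succ_zero]
    simp [coeffArray, coeff_one, eq_comm (a := (0 : Fin 2 →₀ ℕ)), expPair_eq_zero]
  contrapose! hcoeff
  exact coeffArray_eq_zero (by simpa using hcoeff)

end CommRing

theorem totalDegree_add_three_le {R : Type*} [CommRing R] [LinearOrder R] [IsStrictOrderedRing R]
    {f : MvPolynomial (Fin 2) R} (hpos : ∀ e, 0 ≤ coeff e f) (hf : f ≠ 1)
    (hdvd : X 0 + X 1 - 1 ∣ f - 1) : f.totalDegree + 3 ≤ 2 * #f.support := by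
  classical
  obtain ⟨q, hq⟩ := hdvd
  have hne : (X 0 + X 1 - 1) * q ≠ 0 := hq ▸ sub_ne_zero.2 hf
  obtain ⟨n, hn, hqn⟩ : ∃ n, f.totalDegree = n + 1 ∧ q.totalDegree ≤ n := by
    have hle : (f - 1).totalDegree ≤ f.totalDegree := by simpa using totalDegree_sub f 1
    rw [hq, totalDegree_mul_of_isDomain (left_ne_zero_of_mul hne) (right_ne_zero_of_mul hne)] at hle
    have := one_le_totalDegree_line (R := R)
    exact ⟨f.totalDegree - 1, by lia, by lia⟩
  have hcoeff {p : ℕ × ℕ} (hp : p ≠ 0) : lineMul (coeffArray q) p = coeffArray f p := by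
    rw [← coeffArray_line_mul, ← hq, coeffArray, coeff_sub, coeff_one,
      if_neg fun h => hp (expPair_eq_zero.1 h.symm), sub_zero, coeffArray]
  have hcount := add_six_le_two_mul_sum_nonzeroInd_lineMul (Q := coeffArray q) (n := n)
    (fun p hp => coeffArray_eq_zero (hqn.trans_lt hp)) (fun p hp => (hcoeff hp).symm ▸ hpos _) (by
      obtain ⟨p, hp, hpf⟩ := exists_coeffArray_ne_zero (f := f) (by rintro rfl; simp at hn)
      rw [hn] at hp
      exact ⟨p, hp, by rwa [hcoeff (by rintro rfl; simp at hp)]⟩)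
  rw [← coeffArray_line_mul, ← hq] at hcount
  have hcard : #(f - 1).support ≤ #f.support + 1 := by
    refine (card_le_card (support_sub _ f 1)).trans ((card_union_le _ _).trans ?_)
    rw [support_one, card_singleton]
  have := sum_nonzeroInd_coeffArray_le (f - 1) (triangle (n + 2))
  lia

end LineMultiples

section Homogeneous

open Finset MvPolynomial

section CommRing

variable {R : Type*} [CommRing R]

/-- The dehomogenization `p(x, y, -1)` of a polynomial `p` in three variables. -/
noncomputable def dehomogenize : MvPolynomial (Fin 3) R →ₐ[R] MvPolynomial (Fin 2) R :=
  aeval ![X 0, X 1, -1]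

lemma dehomogenize_monomial (e : Fin 3 →₀ ℕ) (c : R) :
    dehomogenize (monomial e c) = monomial (expPair (e 0, e 1)) (c * (-1) ^ e 2) := by
  rw [dehomogenize, aeval_monomial, Finsupp.prod_fintype _ _ (by simp), Fin.prod_univ_three,
    monomial_eq, Finsupp.prod_fintype _ _ (by simp), Fin.prod_univ_two, expPair_apply_zero,
    expPair_apply_one]
  simp only [Matrix.cons_val, algebraMap_eq, C_mul, C_pow, C_neg, C_1]
  ring

lemma support_dehomogenize_subset (p : MvPolynomial (Fin 3) R) :
    (dehomogenize p).support ⊆ p.support.image fun e => expPair (e 0, e 1) := by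
  classical
  conv_lhs => rw [p.as_sum, map_sum]
  refine support_sum.trans (biUnion_subset.2 fun e he => ?_)
  rw [dehomogenize_monomial]
  exact support_monomial_subset.trans (singleton_subset_iff.2 (mem_image_of_mem _ he))

lemma totalDegree_dehomogenize_le (p : MvPolynomial (Fin 3) R) :
    (dehomogenize p).totalDegree ≤ p.totalDegree := by
  refine Finset.sup_le fun e he => ?_
  obtain ⟨u, hu, rfl⟩ := mem_image.1 (support_dehomogenize_subset p he)
  refine le_trans ?_ (le_totalDegree hu)
  change (expPair (u 0, u 1)).degree ≤ u.degree
  rw [degree_expPair, Finsupp.degree_eq_sum, Fin.sum_univ_three]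
  exact Nat.le_add_right _ _

lemma line_dvd_dehomogenize {p : MvPolynomial (Fin 3) R} (h : X 0 + X 1 + X 2 ∣ p) :
    X 0 + X 1 - 1 ∣ dehomogenize p := by
  simpa [dehomogenize, sub_eq_add_neg] using map_dvd dehomogenize h

lemma constantCoeff_dehomogenize (p : MvPolynomial (Fin 3) R) :
    constantCoeff (dehomogenize p) = eval ![0, 0, -1] p := by
  have hcomp : (constantCoeff.comp (dehomogenize : _ →ₐ[R] _).toRingHom) = eval ![0, 0, -1] := by
    ext i
    · simp
    · fin_cases i <;> simp [dehomogenize]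
  exact RingHom.congr_fun hcomp p

end CommRing

lemma tildePoly_eq (p : MvPolynomial (Fin 3) ℝ) : tildePoly p = dehomogenize p + 1 := rfl

namespace IsHomogForm

variable {d : ℕ} {p : MvPolynomial (Fin 3) ℝ}

lemma coeff_zero_tildePoly (hp : IsHomogForm d p) : coeff 0 (tildePoly p) = 0 := by
  rw [tildePoly_eq, coeff_add, coeff_zero_one, ← constantCoeff_eq, constantCoeff_dehomogenize,
    hp.eval_last]
  simp

lemma card_support_tildePoly_add_one_le (hp : IsHomogForm d p) :
    #(tildePoly p).support + 1 ≤ monomialRank p := by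
  classical
  have hzero : 0 ∉ (tildePoly p).support := notMem_support_iff.2 hp.coeff_zero_tildePoly
  have hsub : insert 0 (tildePoly p).support ⊆ (dehomogenize p).support := by
    rw [← add_sub_cancel_right (dehomogenize p) 1, ← tildePoly_eq]
    refine insert_subset ?_ fun e he => ?_
    · simp [hp.coeff_zero_tildePoly]
    · have he0 : 0 ≠ e := fun h => hzero (h ▸ he)
      simpa [coeff_one, he0] using he
  rw [← card_insert_of_notMem hzero]
  exact (card_le_card (hsub.trans (support_dehomogenize_subset p))).trans card_image_le

lemma line_dvd_tildePoly_sub_one (hp : IsHomogForm d p) : X 0 + X 1 - 1 ∣ tildePoly p - 1 := by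
  rw [tildePoly_eq, add_sub_cancel_right]
  exact line_dvd_dehomogenize hp.dvd

theorem add_three_le_two_mul_card_support (hp : IsHomogForm d p) :
    d + 3 ≤ 2 * #(tildePoly p).support := by
  have hne : tildePoly p ≠ 1 := fun h => by simpa [h] using hp.coeff_zero_tildePoly
  simpa only [hp.totalDegree_tilde] using totalDegree_add_three_le hp.coeff_nonneg hne
    hp.line_dvd_tildePoly_sub_one

theorem add_five_le_two_mul_monomialRank (hp : IsHomogForm d p) : d + 5 ≤ 2 * monomialRank p := by
  have := hp.add_three_le_two_mul_card_support
  have := hp.card_support_tildePoly_add_one_le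
  lia

end IsHomogForm

end Homogeneous

section Sharpness

open Finset MvPolynomial

section CommRing

variable {R : Type*} [CommRing R]

lemma eval_dickson_one_add (x y : R) (n : ℕ) :
    (Polynomial.dickson 1 (x * y) n).eval (x + y) = x ^ n + y ^ n := by
  induction n using Nat.twoStepInduction with
  | zero =>
    rw [Polynomial.dickson_zero]
    norm_num
  | one => simp
  | more n ih₀ ih₁ =>
    simp only [Polynomial.dickson_add_two, Polynomial.eval_sub, Polynomial.eval_mul,
      Polynomial.eval_X, Polynomial.eval_C, ih₀, ih₁]
    ring

variable (R) in
/-- The two-variable Lucas polynomial in `x` and `y * z`: the polynomial expressing the power sum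
`α ^ n + β ^ n` through `x = α + β` and `y * z = α * β`. -/
noncomputable def lucasPoly (n : ℕ) : MvPolynomial (Fin 3) R :=
  (Polynomial.dickson 1 (X 1 * X 2) n).eval (X 0)

lemma lucasPoly_zero : lucasPoly R 0 = C 2 := by
  rw [lucasPoly, Polynomial.dickson_zero, map_ofNat]
  norm_num

lemma lucasPoly_one : lucasPoly R 1 = X 0 := by
  rw [lucasPoly, Polynomial.dickson_one, Polynomial.eval_X]

lemma lucasPoly_add_two (n : ℕ) :
    lucasPoly R (n + 2) = X 0 * lucasPoly R (n + 1) - X 1 * X 2 * lucasPoly R n := by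
  simp only [lucasPoly, Polynomial.dickson_add_two, Polynomial.eval_sub, Polynomial.eval_mul,
    Polynomial.eval_X, Polynomial.eval_C]

lemma map_lucasPoly {A : Type*} [CommRing A] (g : MvPolynomial (Fin 3) R →+* A) (n : ℕ) :
    g (lucasPoly R n) = (Polynomial.dickson 1 (g (X 1) * g (X 2)) n).eval (g (X 0)) := by
  rw [lucasPoly, ← Polynomial.eval₂_at_apply, ← Polynomial.eval_map, Polynomial.map_dickson,
    map_mul]

lemma dvd_lucasPoly_sub (n : ℕ) :
    X 0 + X 1 + X 2 ∣ lucasPoly R n - ((-X 1) ^ n + (-X 2) ^ n) := by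
  rw [← eval_dickson_one_add, neg_mul_neg, lucasPoly]
  convert Polynomial.sub_dvd_eval_sub (X 0 : MvPolynomial (Fin 3) R) (-X 1 + -X 2) _ using 1
  ring

lemma isWeightedHomogeneous_lucasPoly {M : Type*} [AddCommMonoid M] {w : Fin 3 → M}
    (hw : w 1 + w 2 = 2 • w 0) (n : ℕ) : IsWeightedHomogeneous w (lucasPoly R n) (n • w 0) := by
  induction n using Nat.twoStepInduction with
  | zero =>
    rw [lucasPoly_zero, zero_smul]
    exact isWeightedHomogeneous_C w 2
  | one =>
    rw [lucasPoly_one, one_smul]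
    exact isWeightedHomogeneous_X R w 0
  | more n ih₀ ih₁ =>
    rw [lucasPoly_add_two]
    refine .sub ?_ ?_
    · rw [show (n + 2) • w 0 = w 0 + (n + 1) • w 0 by rw [← succ_nsmul']]
      exact (isWeightedHomogeneous_X R w 0).mul ih₁
    · rw [add_nsmul, add_comm, ← hw]
      exact ((isWeightedHomogeneous_X R w 1).mul (isWeightedHomogeneous_X R w 2)).mul ih₀

lemma isHomogeneous_lucasPoly (n : ℕ) : (lucasPoly R n).IsHomogeneous n := by
  have h := isWeightedHomogeneous_lucasPoly (R := R) (w := (1 : Fin 3 → ℕ)) rfl n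
  rwa [Pi.one_apply, smul_eq_mul, mul_one] at h

lemma exponents_of_mem_support_lucasPoly {n : ℕ} {e : Fin 3 →₀ ℕ}
    (he : e ∈ (lucasPoly R n).support) : e 1 = e 2 ∧ e 0 + 2 * e 1 = n := by
  have hdeg := isHomogeneous_lucasPoly n (mem_support_iff.1 he)
  have hdiff := isWeightedHomogeneous_lucasPoly (w := ![(0 : ℤ), 1, -1]) (by simp) n
    (mem_support_iff.1 he)
  rw [Finsupp.weight_apply, Finsupp.sum_fintype _ _ (by simp), Fin.sum_univ_three] at hdeg hdiff
  simp only [Pi.one_apply, smul_eq_mul, mul_one, Matrix.cons_val_zero, nsmul_zero,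
    Matrix.cons_val_one, Int.nsmul_eq_mul, zero_add, Matrix.cons_val, mul_neg] at hdeg hdiff
  lia

lemma card_support_lucasPoly_le (n : ℕ) : #(lucasPoly R n).support ≤ n / 2 + 1 := by
  rw [← card_range (n / 2 + 1)]
  refine card_le_card_of_injOn (fun e => e 1) (fun e he => ?_) fun e he u hu h => ?_
  · have := exponents_of_mem_support_lucasPoly he
    exact mem_coe.2 (mem_range.2 (by lia))
  · have := exponents_of_mem_support_lucasPoly he
    have := exponents_of_mem_support_lucasPoly hu
    simp only at h
    refine Finsupp.ext fun i => ?_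
    match i with
    | 0 | 1 | 2 => lia

end CommRing

lemma coeff_dehomogenize_lucasPoly_nonneg {R : Type*} [CommRing R] [LinearOrder R]
    [IsStrictOrderedRing R] (n : ℕ) (e : Fin 2 →₀ ℕ) :
    0 ≤ coeff e (dehomogenize (lucasPoly R n)) := by
  classical
  induction n using Nat.twoStepInduction generalizing e with
  | zero =>
    rw [lucasPoly_zero, dehomogenize, algHom_C, algebraMap_eq, coeff_C]
    split_ifs <;> norm_num
  | one =>
    rw [lucasPoly_one, dehomogenize, aeval_X, Matrix.cons_val_zero, coeff_X]
    split_ifs <;> norm_num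
  | more n ih₀ ih₁ =>
    have hrec : dehomogenize (lucasPoly R (n + 2)) =
        X 0 * dehomogenize (lucasPoly R (n + 1)) + X 1 * dehomogenize (lucasPoly R n) := by
      rw [lucasPoly_add_two]
      simp [dehomogenize]
    rw [hrec, coeff_add, coeff_X_mul', coeff_X_mul']
    refine add_nonneg ?_ ?_ <;> split_ifs
    exacts [ih₁ _, le_rfl, ih₀ _, le_rfl]

/-- The extremal polynomial of odd degree `d` for the homogeneous degree estimate. -/
noncomputable def sharpPoly (d : ℕ) : MvPolynomial (Fin 3) ℝ := lucasPoly ℝ d + X 1 ^ d + X 2 ^ d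

lemma isHomogeneous_sharpPoly (d : ℕ) : (sharpPoly d).IsHomogeneous d :=
  ((isHomogeneous_lucasPoly d).add (isHomogeneous_X_pow 1 d)).add (isHomogeneous_X_pow 2 d)

lemma monomialRank_sharpPoly_le (d : ℕ) : monomialRank (sharpPoly d) ≤ d / 2 + 3 := by
  classical
  have hX (i : Fin 3) : #(X i ^ d : MvPolynomial (Fin 3) ℝ).support = 1 := by
    rw [support_X_pow, card_singleton]
  have hadd (f g : MvPolynomial (Fin 3) ℝ) : #(f + g).support ≤ #f.support + #g.support :=
    (card_le_card support_add).trans (card_union_le _ _)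
  calc #(sharpPoly d).support
      ≤ #(lucasPoly ℝ d).support + 1 + 1 := by
        refine (hadd _ _).trans (Nat.add_le_add ((hadd _ _).trans ?_) (hX 2).le)
        rw [hX 1]
    _ ≤ d / 2 + 3 := by have := card_support_lucasPoly_le (R := ℝ) d; lia

variable {d : ℕ}

lemma tildePoly_sharpPoly (hd : Odd d) :
    tildePoly (sharpPoly d) = dehomogenize (lucasPoly ℝ d) + X 1 ^ d := by
  rw [tildePoly_eq, sharpPoly]
  simp [dehomogenize, hd.neg_one_pow]

lemma coeff_tildePoly_sharpPoly (hd : Odd d) (e : Fin 2 →₀ ℕ) :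
    coeff e (tildePoly (sharpPoly d)) =
      coeff e (dehomogenize (lucasPoly ℝ d)) + if Finsupp.single 1 d = e then 1 else 0 := by
  classical
  rw [tildePoly_sharpPoly hd, coeff_add, coeff_X_pow]

lemma totalDegree_tildePoly_sharpPoly (hd : Odd d) :
    (tildePoly (sharpPoly d)).totalDegree = d := by
  apply le_antisymm
  · rw [tildePoly_eq]
    refine (totalDegree_add _ _).trans (max_le ?_ (by simp))
    exact (totalDegree_dehomogenize_le _).trans (isHomogeneous_sharpPoly d).totalDegree_le
  · have hcoeff : 0 < coeff (Finsupp.single 1 d) (tildePoly (sharpPoly d)) := by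
      rw [coeff_tildePoly_sharpPoly hd, if_pos rfl]
      exact add_pos_of_nonneg_of_pos (coeff_dehomogenize_lucasPoly_nonneg d _) one_pos
    simpa using le_totalDegree (mem_support_iff.2 hcoeff.ne')

theorem isHomogForm_sharpPoly (hd : Odd d) : IsHomogForm d (sharpPoly d) where
  homogeneous := isHomogeneous_sharpPoly d
  eval_last t := by
    have hlucas : eval ![0, 0, t] (lucasPoly ℝ d) = 0 := by
      have := eval_dickson_one_add (0 : ℝ) 0 d
      simpa [map_lucasPoly, hd.pos.ne'] using this
    simp [sharpPoly, hlucas, hd.neg_pow, hd.pos.ne']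
  coeff_nonneg e := by
    rw [coeff_tildePoly_sharpPoly hd]
    exact add_nonneg (coeff_dehomogenize_lucasPoly_nonneg d e) (by split_ifs <;> norm_num)
  totalDegree_tilde := totalDegree_tildePoly_sharpPoly hd
  dvd := by
    have h := dvd_lucasPoly_sub (R := ℝ) d
    rwa [hd.neg_pow, hd.neg_pow, ← neg_add, sub_neg_eq_add, ← add_assoc] at h

theorem two_mul_monomialRank_sharpPoly (hd : Odd d) : 2 * monomialRank (sharpPoly d) = d + 5 := by
  have := (isHomogForm_sharpPoly hd).add_five_le_two_mul_monomialRank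
  have := monomialRank_sharpPoly_le d
  grind

theorem two_mul_card_support_tildePoly_sharpPoly (hd : Odd d) :
    2 * #(tildePoly (sharpPoly d)).support = d + 3 := by
  have := two_mul_monomialRank_sharpPoly hd
  have := (isHomogForm_sharpPoly hd).card_support_tildePoly_add_one_le
  have := (isHomogForm_sharpPoly hd).add_three_le_two_mul_card_support
  lia

end Sharpness

section ProperMaps

open Filter Topology

section Restriction

variable {X Y : Type*} [TopologicalSpace X] [TopologicalSpace Y] {U : Set X} {V : Set Y}
  {φ : U → V} {Φ : X → Y}

lemma notMem_of_isProperMap [T2Space X] (hΦ : Continuous Φ) (hφ : ∀ z, (φ z : Y) = Φ z)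
    (hprop : IsProperMap φ) {z : X} (hcl : z ∈ closure U) (hz : z ∉ U) : Φ z ∉ V := by
  intro hV
  have : (comap ((↑) : U → X) (𝓝 z)).NeBot := mem_closure_iff_comap_neBot.1 hcl
  have htend : Tendsto φ (comap (↑) (𝓝 z)) (𝓝 ⟨Φ z, hV⟩) := by
    rw [tendsto_subtype_rng]
    simp only [hφ]
    exact (hΦ.tendsto z).comp tendsto_comap
  obtain ⟨x, -, hx⟩ := hprop.clusterPt_of_mapClusterPt htend.mapClusterPt
  have hne : (𝓝 (x : X) ⊓ 𝓝 z).NeBot :=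
    hx.map continuous_subtype_val.continuousAt tendsto_comap
  exact hz (eq_of_nhds_neBot hne ▸ x.2)

lemma isProperMap_of_notMem [T2Space Y] (hU : IsCompact (closure U)) (hΦ : Continuous Φ)
    (hφ : ∀ z, (φ z : Y) = Φ z) (hbdry : ∀ z ∈ closure U, z ∉ U → Φ z ∉ V) : IsProperMap φ := by
  refine isProperMap_iff_ultrafilter.2 ⟨?_, fun u y hy => ?_⟩
  · rw [continuous_induced_rng, show ((↑) ∘ φ : U → Y) = Φ ∘ (↑) from funext hφ]
    exact hΦ.comp continuous_subtype_val
  · obtain ⟨z, hz, hzu⟩ := hU.ultrafilter_le_nhds (u.map (↑))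
      (le_principal_iff.2 (mem_map.2 (univ_mem' fun w => subset_closure w.2)))
    have hlim : Tendsto (fun w => (φ w : Y)) u (𝓝 (Φ z)) := by
      simp only [hφ]
      exact (hΦ.tendsto z).comp hzu
    have hyz : (y : Y) = Φ z :=
      tendsto_nhds_unique ((continuous_subtype_val.tendsto y).comp hy) hlim
    have hzU : z ∈ U := not_not.1 fun h => hbdry z hz h (hyz ▸ y.2)
    refine ⟨⟨z, hzU⟩, Subtype.ext ((hφ _).trans hyz.symm), ?_⟩
    rw [nhds_induced, ← map_le_iff_le_comap]
    exact hzu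

end Restriction

lemma isProperMap_iff_norm_eq_one {E F : Type*} [NormedAddCommGroup E] [NormedSpace ℝ E]
    [ProperSpace E] [NormedAddCommGroup F] {φ : Metric.ball (0 : E) 1 → Metric.ball (0 : F) 1}
    {Φ : E → F} (hΦ : Continuous Φ) (hφ : ∀ z, (φ z : F) = Φ z) :
    IsProperMap φ ↔ ∀ z, ‖z‖ = 1 → ‖Φ z‖ = 1 := by
  have hclosure : closure (Metric.ball (0 : E) 1) = Metric.closedBall 0 1 :=
    closure_ball _ one_ne_zero
  constructor
  · intro hprop z hz
    have hcl : z ∈ closure (Metric.ball (0 : E) 1) := by simp [hclosure, hz]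
    have hle : ‖Φ z‖ ≤ 1 := by
      have hmaps : Metric.ball (0 : E) 1 ⊆ Φ ⁻¹' Metric.closedBall 0 1 := fun w hw =>
        Metric.ball_subset_closedBall (hφ ⟨w, hw⟩ ▸ (φ ⟨w, hw⟩).2)
      simpa using closure_minimal hmaps (Metric.isClosed_closedBall.preimage hΦ) hcl
    have hnot := notMem_of_isProperMap hΦ hφ hprop hcl (by simp [hz])
    exact hle.antisymm (by simpa using hnot)
  · intro hsphere
    refine isProperMap_of_notMem (hclosure ▸ isCompact_closedBall 0 1) hΦ hφ fun z hz hzU => ?_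
    rw [hclosure, mem_closedBall_zero_iff] at hz
    rw [mem_ball_zero_iff, not_lt] at hzU
    rw [mem_ball_zero_iff, hsphere z (hz.antisymm hzU)]
    exact lt_irrefl _

end ProperMaps

section EvalOnLine

open Finset MvPolynomial

section CommRing

variable {R : Type*} [CommRing R]

lemma line_dvd_sub_aeval (f : MvPolynomial (Fin 2) R) :
    X 0 + X 1 - 1 ∣ f - aeval ![X 0, 1 - X 0] f := by
  set I : Ideal (MvPolynomial (Fin 2) R) := Ideal.span {X 0 + X 1 - 1} with hI
  have hmk : (Ideal.Quotient.mkₐ R I).comp (aeval ![X 0, 1 - X 0]) = Ideal.Quotient.mkₐ R I := by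
    ext i
    fin_cases i
    · simp
    · simp only [AlgHom.comp_apply, aeval_X, Ideal.Quotient.mkₐ_eq_mk]
      refine (Ideal.Quotient.eq.2 ?_).symm
      exact Ideal.mem_span_singleton.2 ⟨1, by
        simp only [Fin.mk_one, Matrix.cons_val_one, Matrix.cons_val_fin_one, mul_one]
        ring⟩
  rw [← Ideal.mem_span_singleton, ← hI, ← Ideal.Quotient.eq]
  exact (AlgHom.congr_fun hmk f).symm

lemma line_dvd_of_eval_eq_zero [IsDomain R] {f : MvPolynomial (Fin 2) R} {S : Set R}
    (hS : S.Infinite) (hf : ∀ t ∈ S, eval ![t, 1 - t] f = 0) : X 0 + X 1 - 1 ∣ f := by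
  have hzero : aeval ![X 0, 1 - X 0] f = (0 : MvPolynomial (Fin 2) R) := by
    refine funext_set (fun _ => S) (fun _ => hS) fun v hv => ?_
    have hcomp : (eval v).comp (aeval ![X 0, 1 - X 0]).toRingHom = eval ![v 0, 1 - v 0] := by
      ext i
      · simp
      · fin_cases i <;> simp
    exact (RingHom.congr_fun hcomp f).trans (hf _ (hv 0 trivial))
  have h := line_dvd_sub_aeval f
  rwa [hzero, sub_zero] at h

lemma eval_eq_one_of_line_dvd {f : MvPolynomial (Fin 2) R} (hdvd : X 0 + X 1 - 1 ∣ f - 1)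
    {v : Fin 2 → R} (hv : v 0 + v 1 = 1) : eval v f = 1 := by
  simpa [hv, sub_eq_zero] using map_dvd (eval v) hdvd

end CommRing

lemma eval_smul_le {σ R : Type*} [CommRing R] [LinearOrder R] [IsStrictOrderedRing R]
    {f : MvPolynomial σ R} (hpos : ∀ e, 0 ≤ coeff e f) (hzero : coeff 0 f = 0) {c : R}
    (hc0 : 0 ≤ c) (hc1 : c ≤ 1) {w : σ → R} (hw : 0 ≤ w) : eval (c • w) f ≤ c * eval w f := by
  rw [eval_eq, eval_eq, mul_sum]
  refine sum_le_sum fun e he => ?_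
  have hdeg : e.degree ≠ 0 := by
    rw [Ne, Finsupp.degree_eq_zero_iff]
    rintro rfl
    exact mem_support_iff.1 he hzero
  have hterm : 0 ≤ coeff e f * ∏ i ∈ e.support, w i ^ e i :=
    mul_nonneg (hpos e) (prod_nonneg fun i _ => pow_nonneg (hw i) _)
  calc coeff e f * ∏ i ∈ e.support, (c • w) i ^ e i
      = c ^ e.degree * (coeff e f * ∏ i ∈ e.support, w i ^ e i) := by
        simp only [Pi.smul_apply, smul_eq_mul, mul_pow, prod_mul_distrib, prod_pow_eq_pow_sum,
          Finsupp.degree_apply]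
        ring
    _ ≤ c * (coeff e f * ∏ i ∈ e.support, w i ^ e i) :=
        mul_le_mul_of_nonneg_right (pow_le_of_le_one hc0 hc1 hdeg) hterm

lemma eval_le_of_line_dvd {R : Type*} [Field R] [LinearOrder R] [IsStrictOrderedRing R]
    {f : MvPolynomial (Fin 2) R} (hpos : ∀ e, 0 ≤ coeff e f) (hzero : coeff 0 f = 0)
    (hdvd : X 0 + X 1 - 1 ∣ f - 1) {v : Fin 2 → R} (hv : 0 ≤ v) (hle : v 0 + v 1 ≤ 1) :
    eval v f ≤ v 0 + v 1 := by
  have hsum : 0 ≤ v 0 + v 1 := add_nonneg (hv 0) (hv 1)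
  obtain ⟨w, hw, hline, hvw⟩ : ∃ w, 0 ≤ w ∧ w 0 + w 1 = 1 ∧ v = (v 0 + v 1) • w := by
    rcases hsum.eq_or_lt with h | h
    · obtain ⟨h0, h1⟩ := (add_eq_zero_iff_of_nonneg (hv 0) (hv 1)).1 h.symm
      refine ⟨![1, 0], fun j => ?_, by simp, funext fun j => ?_⟩ <;> fin_cases j <;> simp [h0, h1]
    · refine ⟨(v 0 + v 1)⁻¹ • v, smul_nonneg (inv_nonneg.2 hsum) hv, ?_, ?_⟩
      · simp only [Pi.smul_apply, smul_eq_mul, ← mul_add, inv_mul_cancel₀ h.ne']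
      · rw [smul_inv_smul₀ h.ne']
  calc eval v f = eval ((v 0 + v 1) • w) f := by rw [← hvw]
    _ ≤ (v 0 + v 1) * eval w f := eval_smul_le hpos hzero hsum hle hw
    _ = v 0 + v 1 := by rw [eval_eq_one_of_line_dvd hdvd hline, mul_one]

end EvalOnLine

section MonomialMaps

open Finset MvPolynomial

variable {σ ι : Type*}

/-- The map with components the monomials `C i * z ^ a i`. -/
noncomputable def monomialMap (a : ι → σ →₀ ℕ) (C : ι → ℂ) (z : EuclideanSpace ℂ σ) :
    EuclideanSpace ℂ ι :=
  WithLp.toLp 2 fun i => eval z (monomial (a i) (C i))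

lemma continuous_monomialMap {a : ι → σ →₀ ℕ} {C : ι → ℂ} :
    Continuous (monomialMap a C) :=
  (PiLp.continuous_toLp 2 _).comp <| continuous_pi fun i =>
    (continuous_eval (monomial (a i) (C i))).comp (PiLp.continuous_ofLp 2 _)

variable [Fintype ι]

/-- The polynomial whose value at `(|z₁|², …, |zₙ|²)` is the squared norm of the monomial map. -/
noncomputable def normSqPoly (a : ι → σ →₀ ℕ) (C : ι → ℂ) : MvPolynomial σ ℝ :=
  ∑ i, monomial (a i) (‖C i‖ ^ 2)

section NormSqPoly

variable {a : ι → σ →₀ ℕ} {C : ι → ℂ}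

lemma norm_sq_monomialMap (z : EuclideanSpace ℂ σ) :
    ‖monomialMap a C z‖ ^ 2 = eval (fun j => ‖z j‖ ^ 2) (normSqPoly a C) := by
  rw [EuclideanSpace.norm_sq_eq, normSqPoly, map_sum]
  refine sum_congr rfl fun i _ => ?_
  simp only [monomialMap, eval_monomial, norm_mul, mul_pow, Finsupp.prod, norm_prod, norm_pow,
    ← prod_pow, pow_right_comm]

lemma coeff_normSqPoly [DecidableEq σ] (e : σ →₀ ℕ) :
    coeff e (normSqPoly a C) = ∑ i, if a i = e then ‖C i‖ ^ 2 else 0 := by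
  simp only [normSqPoly, coeff_sum, coeff_monomial]

lemma coeff_normSqPoly_nonneg (e : σ →₀ ℕ) : 0 ≤ coeff e (normSqPoly a C) := by
  classical
  rw [coeff_normSqPoly]
  exact sum_nonneg fun i _ => by split_ifs <;> positivity

lemma card_support_normSqPoly_le : #(normSqPoly a C).support ≤ Fintype.card ι := by
  classical
  have hsub : (normSqPoly a C).support ⊆ univ.image a :=
    support_sum.trans <| biUnion_subset.2 fun i hi =>
      support_monomial_subset.trans (singleton_subset_iff.2 (mem_image_of_mem a hi))
  exact (card_le_card hsub).trans card_image_le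

lemma totalDegree_normSqPoly :
    (normSqPoly a C).totalDegree = univ.sup fun i => (monomial (a i) (C i)).totalDegree := by
  classical
  apply le_antisymm
  · refine (totalDegree_finsetSum _ _).trans (Finset.sup_mono_fun fun i _ => ?_)
    by_cases h : C i = 0
    · simp [h]
    · rw [totalDegree_monomial _ h]
      exact totalDegree_monomial_le _ _
  · refine Finset.sup_le fun i _ => ?_
    by_cases h : C i = 0
    · simp [h]
    · have hcoeff : 0 < coeff (a i) (normSqPoly a C) := by
        rw [coeff_normSqPoly]
        exact sum_pos' (fun j _ => by split_ifs <;> positivity)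
          ⟨i, mem_univ i, by rw [if_pos rfl]; positivity⟩
      rw [totalDegree_monomial _ h]
      exact le_totalDegree (mem_support_iff.2 hcoeff.ne')

end NormSqPoly

lemma isMonomialMapOfDegree_iff {n k d : ℕ} {φ : UnitBall n → UnitBall k} :
    IsMonomialMapOfDegree φ d ↔ ∃ (a : Fin k → Fin n →₀ ℕ) (C : Fin k → ℂ),
      (∀ z, (φ z : EuclideanSpace ℂ (Fin k)) = monomialMap a C z) ∧
        (normSqPoly a C).totalDegree = d := by
  constructor
  · rintro ⟨f, hmon, heval, hdeg⟩
    choose a C hf using hmon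
    obtain rfl : f = fun i => monomial (a i) (C i) := funext hf
    exact ⟨a, C, fun z => PiLp.ext fun i => heval z i, totalDegree_normSqPoly.trans hdeg⟩
  · rintro ⟨a, C, hφ, hdeg⟩
    exact ⟨fun i => monomial (a i) (C i), fun i => ⟨a i, C i, rfl⟩,
      fun z i => congrArg (fun w => w i) (hφ z), totalDegree_normSqPoly.symm.trans hdeg⟩

lemma exists_normSqPoly_eq {f : MvPolynomial σ ℝ} (hpos : ∀ e, 0 ≤ coeff e f) :
    ∃ (a : Fin #f.support → σ →₀ ℕ) (C : Fin #f.support → ℂ), normSqPoly a C = f := by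
  let e := f.support.equivFin.symm
  refine ⟨fun i => e i, fun i => (√(coeff (e i) f) : ℝ), ?_⟩
  have hC (i) : ‖((√(coeff (e i) f) : ℝ) : ℂ)‖ ^ 2 = coeff (e i) f := by
    rw [Complex.norm_real, Real.norm_eq_abs, sq_abs, Real.sq_sqrt (hpos _)]
  simp only [normSqPoly, hC]
  rw [e.sum_comp fun s : f.support => monomial (s : σ →₀ ℕ) (coeff s f),
    sum_coe_sort f.support fun s => monomial s (coeff s f), ← f.as_sum]

lemma exists_norm_eq_one_norm_sq_eq {t : ℝ} (ht : t ∈ Set.Icc 0 1) :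
    ∃ z : EuclideanSpace ℂ (Fin 2), ‖z‖ = 1 ∧ (fun j => ‖z j‖ ^ 2) = ![t, 1 - t] := by
  have hz : (fun j => ‖!₂[((√t : ℝ) : ℂ), (√(1 - t) : ℝ)] j‖ ^ 2) = ![t, 1 - t] := by
    ext j
    fin_cases j
    · simp [Real.sq_sqrt ht.1]
    · simp [Real.sq_sqrt (sub_nonneg.2 ht.2)]
  refine ⟨_, ?_, hz⟩
  rw [← sq_eq_sq₀ (norm_nonneg _) zero_le_one, EuclideanSpace.norm_sq_eq, one_pow]
  exact (congrArg (fun v => ∑ j, v j) hz).trans (show ∑ j, ![t, 1 - t] j = 1 by simp)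

lemma isProperMap_iff_line_dvd {k : ℕ} {a : Fin k → Fin 2 →₀ ℕ} {C : Fin k → ℂ}
    {φ : UnitBall 2 → UnitBall k}
    (hφ : ∀ z, (φ z : EuclideanSpace ℂ (Fin k)) = monomialMap a C z) :
    IsProperMap φ ↔ X 0 + X 1 - 1 ∣ normSqPoly a C - 1 := by
  rw [isProperMap_iff_norm_eq_one continuous_monomialMap hφ]
  constructor
  · refine fun hsphere => line_dvd_of_eval_eq_zero (Set.Icc_infinite zero_lt_one) fun t ht => ?_
    obtain ⟨z, hz, hzt⟩ := exists_norm_eq_one_norm_sq_eq ht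
    rw [← hzt, map_sub, map_one, ← norm_sq_monomialMap, hsphere z hz, one_pow, sub_self]
  · intro hdvd z hz
    have hline : ‖z 0‖ ^ 2 + ‖z 1‖ ^ 2 = 1 := by
      rw [← Fin.sum_univ_two fun j => ‖z j‖ ^ 2, ← EuclideanSpace.norm_sq_eq, hz, one_pow]
    rw [← sq_eq_sq₀ (norm_nonneg _) zero_le_one, norm_sq_monomialMap,
      eval_eq_one_of_line_dvd hdvd hline, one_pow]

theorem degree_add_three_le_of_isProperMap {k d : ℕ} {φ : UnitBall 2 → UnitBall k}
    (hprop : IsProperMap φ) (hmon : IsMonomialMapOfDegree φ d) : d + 3 ≤ 2 * k := by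
  obtain ⟨a, C, hφ, rfl⟩ := isMonomialMapOfDegree_iff.1 hmon
  have hne : normSqPoly a C ≠ 1 := by
    intro h
    have hlt := mem_ball_zero_iff.1 (φ ⟨0, by simp⟩).2
    rw [hφ, ← sq_lt_one_iff₀ (norm_nonneg _), norm_sq_monomialMap, h, map_one] at hlt
    exact lt_irrefl _ hlt
  have hdeg := totalDegree_add_three_le coeff_normSqPoly_nonneg hne
    ((isProperMap_iff_line_dvd hφ).1 hprop)
  have hcard := card_support_normSqPoly_le (a := a) (C := C)
  rw [Fintype.card_fin] at hcard
  lia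

theorem exists_isProperMap_of_line_dvd {f : MvPolynomial (Fin 2) ℝ} (hpos : ∀ e, 0 ≤ coeff e f)
    (hzero : coeff 0 f = 0) (hdvd : X 0 + X 1 - 1 ∣ f - 1) :
    ∃ φ : UnitBall 2 → UnitBall #f.support,
      IsProperMap φ ∧ IsMonomialMapOfDegree φ f.totalDegree := by
  obtain ⟨a, C, hf⟩ := exists_normSqPoly_eq hpos
  have hball (z : UnitBall 2) : monomialMap a C z ∈ Metric.ball 0 1 := by
    have hz := mem_ball_zero_iff.1 z.2
    rw [← sq_lt_one_iff₀ (norm_nonneg _), EuclideanSpace.norm_sq_eq, Fin.sum_univ_two] at hz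
    rw [mem_ball_zero_iff, ← sq_lt_one_iff₀ (norm_nonneg _), norm_sq_monomialMap, hf]
    exact (eval_le_of_line_dvd hpos hzero hdvd (fun j => by positivity) hz.le).trans_lt hz
  refine ⟨fun z => ⟨monomialMap a C z, hball z⟩, ?_, ?_⟩
  · exact (isProperMap_iff_line_dvd fun _ => rfl).2 (hf.symm ▸ hdvd)
  · exact isMonomialMapOfDegree_iff.2 ⟨a, C, fun _ => rfl, by rw [hf]⟩

theorem exists_isProperMap_of_odd {d k : ℕ} (hd : Odd d) (hk : d + 3 = 2 * k) :
    ∃ φ : UnitBall 2 → UnitBall k, IsProperMap φ ∧ IsMonomialMapOfDegree φ d := by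
  have hp := isHomogForm_sharpPoly hd
  have hcard : #(tildePoly (sharpPoly d)).support = k := by
    have := two_mul_card_support_tildePoly_sharpPoly hd
    lia
  have h := exists_isProperMap_of_line_dvd hp.coeff_nonneg hp.coeff_zero_tildePoly
    hp.line_dvd_tildePoly_sub_one
  rwa [hcard, hp.totalDegree_tilde] at h

end MonomialMaps

theorem mainTheorem7 :
    -- the degree estimate for proper monomial maps from `B_2` to `B_k`
    (∀ (k d : ℕ) (φ : UnitBall 2 → UnitBall k),
      IsProperMap φ → IsMonomialMapOfDegree φ d → (d : ℤ) ≤ 2 * (k : ℤ) - 3) ∧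
    -- its sharpness, in every target dimension `k ≥ 2`
    (∀ k : ℕ, 2 ≤ k → ∃ (d : ℕ) (φ : UnitBall 2 → UnitBall k),
      IsProperMap φ ∧ IsMonomialMapOfDegree φ d ∧ (d : ℤ) = 2 * (k : ℤ) - 3) ∧
    -- the homogeneous form
    (∀ (d : ℕ) (p : MvPolynomial (Fin 3) ℝ),
      IsHomogForm d p → ((d : ℝ) + 5) / 2 ≤ (monomialRank p : ℝ)) ∧
    -- its sharpness, in every odd degree
    (∀ d : ℕ, Odd d → ∃ p : MvPolynomial (Fin 3) ℝ,
      IsHomogForm d p ∧ (monomialRank p : ℝ) = ((d : ℝ) + 5) / 2) := by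
  refine ⟨fun k d φ hprop hmon => ?_, fun k hk => ?_, fun d p hp => ?_, fun d hd => ?_⟩
  · have := degree_add_three_le_of_isProperMap hprop hmon
    lia
  · obtain ⟨φ, hprop, hmon⟩ := exists_isProperMap_of_odd (d := 2 * k - 3) (k := k)
      ⟨k - 2, by lia⟩ (by lia)
    exact ⟨2 * k - 3, φ, hprop, hmon, by lia⟩
  · have : (d + 5 : ℝ) ≤ 2 * monomialRank p := mod_cast hp.add_five_le_two_mul_monomialRank
    linarith
  · have : (2 * monomialRank (sharpPoly d) : ℝ) = d + 5 := mod_cast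
      two_mul_monomialRank_sharpPoly hd
    exact ⟨sharpPoly d, isHomogForm_sharpPoly hd, by linarith⟩
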